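/- Let $\log\Gamma(z)$ denote, for $\operatorname{Re} z>0$, the analytic branch of the logarithm of the Gamma function that is real on the positive real axis (equivalently, $\log\Gamma(1)=0$), and let $\log z$ be the principal branch. Binet's function is \[ \mu(z)=\log\Gamma(z)-\left(z-\tfrac12\right)\log z+z-\tfrac12\log(2\pi),\qquad \operatorname{Re} z>0 . \] Let $S_m^{(k)}$ be the (signed) Stirling numbers of the first kind, defined by $\prod_{j=0}^{m-1}(x-j)=\sum_{k=0}^{m}S_m^{(k)}x^k$, and define the rational numbers \[ c_m=\frac{(-1)^{m-1}}{2m}\sum_{k=1}^{m}\frac{k\,S_m^{(k)}}{(k+1)(k+2)}\qquad(m\ge 1). \] Then for every complex $z$ with $\operatorname{Re} z>0$ the series below converges (absolutely), and \[ \mu(z)=\frac1z\sum_{m=1}^{\infty}\frac{c_m}{\prod_{k=1}^{m-1}(z+k)} . \] -/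

import Mathlib

noncomputable section

namespace BinetSeries

/-- The analytic branch of `log Γ` with `log Γ(1) = 0`: the integral of the digamma function
`Γ' / Γ` along the segment from `1` to `z`. It is used for `0 < re z` (where `Γ` has neither zeros
nor poles); `exp_logGamma` shows that it is a logarithm of `Γ` there. Note that
`Complex.log (Complex.Gamma z)` would have jumps in that half plane. -/
def logGamma (z : ℂ) : ℂ :=
  ∫ t in (0 : ℝ)..1, (z - 1) * Complex.digamma (1 + (t : ℂ) * (z - 1))

/-- Binet's function `μ(z) = log Γ(z) - (z - 1/2) log z + z - (1/2) log (2π)`, with the principal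
branch of `log z`. -/
def binetMu (z : ℂ) : ℂ :=
  logGamma z - (z - 1 / 2) * Complex.log z + z - 1 / 2 * Complex.log (2 * (Real.pi : ℂ))

/-- The (signed) Stirling number of the first kind `S_m^{(k)}`: the coefficient of `x ^ k` in the
falling factorial `x (x - 1) ⋯ (x - m + 1)`. -/
def stirlingS (m k : ℕ) : ℤ :=
  (descPochhammer ℤ m).coeff k

/-- The rational coefficients
`c_m = ((-1)^(m-1) / (2m)) * ∑_{k=1}^m k S_m^{(k)} / ((k+1)(k+2))`, for `m ≥ 1`. -/
def binetCoeff (m : ℕ) : ℚ :=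
  (-1) ^ (m - 1) / (2 * (m : ℚ)) *
    ∑ k ∈ Finset.Icc 1 m, (k : ℚ) * (stirlingS m k : ℚ) / (((k : ℚ) + 1) * ((k : ℚ) + 2))

/-- `logGamma` is a logarithm of the Gamma function on the right half plane. -/
theorem exp_logGamma {z : ℂ} (hz : 0 < z.re) : Complex.exp (logGamma z) = Complex.Gamma z := by
  have hre : ∀ t ∈ Set.Icc (0 : ℝ) 1, 0 < (1 + (t : ℂ) * (z - 1)).re := by
    intro t ht
    have h1 : (1 + (t : ℂ) * (z - 1)).re = (1 - t) + t * z.re := by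
      simp; ring
    rw [h1]
    rcases eq_or_lt_of_le ht.1 with h | h
    · subst h; norm_num
    · have := mul_pos h hz
      linarith [ht.2]
  have hpole : ∀ w : ℂ, 0 < w.re → ∀ m : ℕ, w ≠ -m := by
    intro w hw m h
    rw [h] at hw
    simp at hw
    linarith [(Nat.cast_nonneg m : (0 : ℝ) ≤ m)]
  have hdG : DifferentiableOn ℂ Complex.Gamma {w : ℂ | 0 < w.re} := fun w hw =>
    (Complex.differentiableAt_Gamma w (hpole w hw)).differentiableWithinAt
  have hopen : IsOpen {w : ℂ | 0 < w.re} := isOpen_lt continuous_const Complex.continuous_re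
  have hcont : ContinuousOn Complex.digamma {w : ℂ | 0 < w.re} := by
    have : ContinuousOn (fun w => deriv Complex.Gamma w / Complex.Gamma w) {w : ℂ | 0 < w.re} :=
      (hdG.deriv hopen).continuousOn.div hdG.continuousOn
        (fun w hw => Complex.Gamma_ne_zero_of_re_pos hw)
    exact this
  set γ : ℝ → ℂ := fun t => 1 + (t : ℂ) * (z - 1) with hγ
  have hγc : Continuous γ := by fun_prop
  have hγd : ∀ t, HasDerivAt γ (z - 1) t := by
    intro t
    have h := ((Complex.ofRealCLM.hasDerivAt (x := t)).mul_const (z - 1)).const_add 1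
    rw [Complex.ofRealCLM_apply, Complex.ofReal_one, one_mul] at h
    exact h
  set f : ℝ → ℂ := fun t => (z - 1) * Complex.digamma (γ t) with hf
  have hfc : ContinuousOn f (Set.Icc 0 1) :=
    continuousOn_const.mul (hcont.comp hγc.continuousOn hre)
  set F : ℝ → ℂ := fun s => ∫ t in (0 : ℝ)..s, f t with hF
  have hFc : ContinuousOn F (Set.Icc 0 1) := by
    have := intervalIntegral.continuousOn_primitive_interval (f := f) (a := 0) (b := 1)
      (μ := MeasureTheory.volume)
      (by rw [Set.uIcc_of_le zero_le_one]; exact hfc.integrableOn_Icc)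
    rwa [Set.uIcc_of_le zero_le_one] at this
  have hFd : ∀ s ∈ Set.Ioo (0 : ℝ) 1, HasDerivAt F (f s) s := by
    intro s hs
    have hn : Set.Icc (0 : ℝ) 1 ∈ nhds s := Icc_mem_nhds hs.1 hs.2
    refine intervalIntegral.integral_hasDerivAt_right ?_ ?_ (hfc.continuousAt hn)
    · refine (hfc.mono ?_).intervalIntegrable
      rw [Set.uIcc_of_le hs.1.le]
      exact Set.Icc_subset_Icc le_rfl hs.2.le
    · exact (hfc.mono Set.Ioo_subset_Icc_self).stronglyMeasurableAtFilter isOpen_Ioo s hs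
  set g : ℝ → ℂ := fun s => Complex.exp (-F s) * Complex.Gamma (γ s) with hg
  have hgc : ContinuousOn g (Set.Icc 0 1) :=
    (Complex.continuous_exp.comp_continuousOn hFc.neg).mul
      (hdG.continuousOn.comp hγc.continuousOn hre)
  have hgd : ∀ s ∈ Set.Ioo (0 : ℝ) 1, HasDerivAt g 0 s := by
    intro s hs
    have hw := hre s ⟨hs.1.le, hs.2.le⟩
    have h1 := ((hFd s hs).neg).cexp
    have h2 : HasDerivAt (fun t => Complex.Gamma (γ t)) (deriv Complex.Gamma (γ s) * (z - 1)) s :=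
      ((Complex.differentiableAt_Gamma _ (hpole _ hw)).hasDerivAt).comp s (hγd s)
    have h3 := h1.mul h2
    have h5 : Complex.Gamma (γ s) ≠ 0 := Complex.Gamma_ne_zero_of_re_pos hw
    have h4 : f s = (z - 1) * (deriv Complex.Gamma (γ s) / Complex.Gamma (γ s)) := rfl
    refine h3.congr_deriv ?_
    rw [h4]
    field_simp
    ring
  have hconst : g 1 = g 0 := by
    apply Complex.ext
    · obtain ⟨c, hc, h⟩ := exists_hasDerivAt_eq_slope (fun s => (g s).re) (fun _ => 0) zero_lt_one
        (Complex.continuous_re.comp_continuousOn hgc)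
        (fun s hs => (Complex.reCLM.hasFDerivAt (x := g s)).comp_hasDerivAt s (hgd s hs))
      norm_num at h
      linarith
    · obtain ⟨c, hc, h⟩ := exists_hasDerivAt_eq_slope (fun s => (g s).im) (fun _ => 0) zero_lt_one
        (Complex.continuous_im.comp_continuousOn hgc)
        (fun s hs => (Complex.imCLM.hasFDerivAt (x := g s)).comp_hasDerivAt s (hgd s hs))
      norm_num at h
      linarith
  have h0 : g 0 = 1 := by simp [hg, hF, hγ]
  have h1 : g 1 = Complex.exp (-logGamma z) * Complex.Gamma z := by
    simp [hg, hF, hγ, hf, logGamma]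
  rw [h1, h0, Complex.exp_neg] at hconst
  field_simp [Complex.exp_ne_zero] at hconst
  exact hconst.symm

end BinetSeries

end

/-! For `x > 0`, Binet's function and the series satisfy the same difference equation, `f x - f (x +
1) = (x + 1/2) log ((x + 1) / x) - 1`, and both tend to `0` along `x + n`. Their difference is
therefore zero (`realBinetMu_eq_realBinetSeries`), and the identity theorem extends the equality to
the half plane. For the series, the point is that `(n + 1) c_{n+1}` is the integral over `[0, 1]` of
`(t - 1/2) t (1 - t) ⋯ (n - t)` (`binetCoeff_succ_eq_integral`). Subtracting the shifted series
termwise produces this factor `n + 1`; Gauss's sum `hasSum_risingProd_neg_div` under the integral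
then leaves an elementary integral. For `μ`, the decay combines Stirling's formula with Euler's
limit for `log Γ`. -/

noncomputable section

namespace BinetSeries

open Filter Topology MeasureTheory

/-! ### Rising factorials and Gauss's sum. -/

/-- The shifted rising factorial `(x + 1) (x + 2) ⋯ (x + n)`. -/
def risingProd {R : Type*} [CommRing R] (x : R) (n : ℕ) : R :=
  ∏ k ∈ Finset.Icc 1 n, (x + (k : R))

@[simp] theorem risingProd_zero {R : Type*} [CommRing R] (x : R) : risingProd x 0 = 1 := by
  simp [risingProd]

theorem risingProd_succ {R : Type*} [CommRing R] (x : R) (n : ℕ) :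
    risingProd x (n + 1) = risingProd x n * (x + ((n : R) + 1)) := by
  simp [risingProd, Finset.prod_Icc_succ_top]

theorem risingProd_add_one {R : Type*} [CommRing R] (x : R) (n : ℕ) :
    (x + 1) * risingProd (x + 1) n = risingProd x (n + 1) := by
  induction n with
  | zero => simp [risingProd_succ]
  | succ n ih =>
    rw [risingProd_succ, ← mul_assoc, ih, risingProd_succ x (n + 1)]
    push_cast
    ring

theorem risingProd_pos {x : ℝ} (hx : 0 ≤ x) (n : ℕ) : 0 < risingProd x n :=
  Finset.prod_pos fun k hk => by
    have : (1 : ℝ) ≤ k := by exact_mod_cast (Finset.mem_Icc.1 hk).1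
    linarith

theorem risingProd_mono {x y : ℝ} (hx : 0 ≤ x) (hxy : x ≤ y) (n : ℕ) :
    risingProd x n ≤ risingProd y n :=
  Finset.prod_le_prod (fun k _ => by positivity) fun k _ => by linarith

theorem risingProd_re_le_norm {z : ℂ} (hz : 0 ≤ z.re) (n : ℕ) :
    risingProd z.re n ≤ ‖risingProd z n‖ := by
  rw [risingProd, risingProd, norm_prod]
  refine Finset.prod_le_prod (fun k _ => by positivity) fun k _ => ?_
  have := Complex.re_le_norm (z + k)
  simpa using this

theorem risingProd_neg_nonneg {t : ℝ} (ht : t ≤ 1) (n : ℕ) : 0 ≤ risingProd (-t) n :=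
  Finset.prod_nonneg fun k hk => by
    have : (1 : ℝ) ≤ k := by exact_mod_cast (Finset.mem_Icc.1 hk).1
    linarith

theorem risingProd_neg_le_factorial {t : ℝ} (h0 : 0 ≤ t) (ht : t ≤ 1) (n : ℕ) :
    risingProd (-t) n ≤ n.factorial := by
  induction n with
  | zero => simp
  | succ n ih =>
    rw [risingProd_succ, Nat.factorial_succ]
    push_cast
    rw [mul_comm]
    refine mul_le_mul (by linarith) ih (risingProd_neg_nonneg ht n) (by positivity)

theorem continuous_risingProd {R : Type*} [CommRing R] [TopologicalSpace R] [IsTopologicalRing R]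
    (n : ℕ) : Continuous fun x : R => risingProd x n := by
  unfold risingProd
  fun_prop

/-- The quotient is the product of the factors `1 + x / i`; divergence of the harmonic series then
forces `n! / risingProd x n → 0`. -/
theorem one_add_harmonic_le_risingProd_div {x : ℝ} (hx : 0 ≤ x) (n : ℕ) :
    1 + x * ∑ i ∈ Finset.range n, 1 / ((i : ℝ) + 1) ≤ risingProd x n / n.factorial := by
  have hone : ∀ n : ℕ, 1 ≤ risingProd x n / n.factorial := by
    intro n
    rw [one_le_div (by positivity)]
    induction n with
    | zero => simp
    | succ n ih =>
      rw [risingProd_succ, Nat.factorial_succ]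
      push_cast
      rw [mul_comm]
      exact mul_le_mul ih (by linarith) (by positivity) (risingProd_pos hx n).le
  induction n with
  | zero => simp
  | succ n ih =>
    have h : risingProd x (n + 1) / (n + 1).factorial =
        risingProd x n / n.factorial * (1 + x / ((n : ℝ) + 1)) := by
      rw [risingProd_succ, Nat.factorial_succ]
      push_cast
      field_simp
      ring
    rw [h, Finset.sum_range_succ]
    have h2 : x / ((n : ℝ) + 1) ≤ risingProd x n / n.factorial * (x / ((n : ℝ) + 1)) :=
      le_mul_of_one_le_left (by positivity) (hone n)
    have h3 : x * (1 / ((n : ℝ) + 1)) = x / ((n : ℝ) + 1) := by ring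
    linarith

theorem tendsto_factorial_div_risingProd {x : ℝ} (hx : 0 < x) :
    Tendsto (fun n : ℕ => (n.factorial : ℝ) / risingProd x n) atTop (𝓝 0) := by
  have h : Tendsto (fun n : ℕ => risingProd x n / n.factorial) atTop atTop :=
    tendsto_atTop_mono (one_add_harmonic_le_risingProd_div hx.le)
      (tendsto_atTop_add_const_left _ 1
        (Real.tendsto_sum_range_one_div_nat_succ_atTop.const_mul_atTop hx))
  exact h.inv_tendsto_atTop.congr fun n => by simp

/-- A telescoping form of Gauss's summation formula `₂F₁(1 - t, 1; x + 2; 1)`. -/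
theorem hasSum_risingProd_neg_div {x t : ℝ} (hx : 0 < x) (h0 : 0 ≤ t) (ht : t ≤ 1) :
    HasSum (fun n : ℕ => risingProd (-t) n / risingProd x (n + 1)) (1 / (x + t)) := by
  rw [hasSum_iff_tendsto_nat_of_nonneg fun n =>
    div_nonneg (risingProd_neg_nonneg ht n) (risingProd_pos hx.le _).le]
  have hxt : 0 < x + t := by linarith
  -- Telescopes because `(x + n + 1) - (n + 1 - t) = x + t`.
  have hsum : ∀ n : ℕ, ∑ i ∈ Finset.range n, risingProd (-t) i / risingProd x (i + 1) =
      1 / (x + t) * (1 - risingProd (-t) n / risingProd x n) := by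
    intro n
    induction n with
    | zero => simp
    | succ n ih =>
      rw [Finset.sum_range_succ, ih, risingProd_succ, risingProd_succ]
      have := (risingProd_pos hx.le n).ne'
      have : x + ((n : ℝ) + 1) ≠ 0 := by positivity
      field_simp
      ring
  simp_rw [hsum]
  have hlim : Tendsto (fun n : ℕ => risingProd (-t) n / risingProd x n) atTop (𝓝 0) :=
    squeeze_zero
      (fun n => div_nonneg (risingProd_neg_nonneg ht n) (risingProd_pos hx.le _).le)
      (fun n => div_le_div_of_nonneg_right (risingProd_neg_le_factorial h0 ht n)
        (risingProd_pos hx.le n).le) (tendsto_factorial_div_risingProd hx)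
  simpa using (hlim.const_sub 1).const_mul (1 / (x + t))

theorem risingProd_neg_zero (n : ℕ) : risingProd (-0 : ℝ) n = n.factorial := by
  induction n with
  | zero => simp
  | succ n ih =>
    rw [risingProd_succ, ih, Nat.factorial_succ]
    push_cast
    ring

theorem summable_factorial_div_risingProd_succ {x : ℝ} (hx : 0 < x) :
    Summable fun n : ℕ => (n.factorial : ℝ) / risingProd x (n + 1) := by
  simpa only [risingProd_neg_zero] using
    (hasSum_risingProd_neg_div hx le_rfl zero_le_one).summable

theorem summable_factorial_div_succ_mul_risingProd {x : ℝ} (hx : 0 < x) :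
    Summable fun n : ℕ => (n.factorial : ℝ) / ((n + 1) * risingProd x n) := by
  refine Summable.of_nonneg_of_le
    (fun n => by have := risingProd_pos hx.le n; positivity) (fun n => ?_)
    ((summable_factorial_div_risingProd_succ hx).mul_left (x + 1))
  have h := risingProd_pos hx.le n
  rw [risingProd_succ, ← mul_div_assoc, div_le_div_iff₀ (by positivity) (by positivity)]
  have h2 : x + ((n : ℝ) + 1) ≤ (x + 1) * (n + 1) := by
    nlinarith [mul_nonneg hx.le (Nat.cast_nonneg (α := ℝ) n)]
  calc (n.factorial : ℝ) * (risingProd x n * (x + (n + 1)))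
      ≤ n.factorial * (risingProd x n * ((x + 1) * (n + 1))) := by gcongr
    _ = _ := by ring

/-! ### Integral form of the coefficients, and convergence. -/

theorem eval_descPochhammer_succ (n : ℕ) (t : ℝ) :
    (descPochhammer ℝ (n + 1)).eval t = (-1) ^ n * (t * risingProd (-t) n) := by
  induction n with
  | zero => simp
  | succ n ih =>
    rw [descPochhammer_succ_right, Polynomial.eval_mul, ih, risingProd_succ]
    simp
    ring

theorem eval_descPochhammer_eq_sum (n : ℕ) (t : ℝ) :
    (descPochhammer ℝ (n + 1)).eval t =
      ∑ k ∈ Finset.Icc 1 (n + 1), (stirlingS (n + 1) k : ℝ) * t ^ k := by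
  have hc : ∀ k, (descPochhammer ℝ (n + 1)).coeff k = (stirlingS (n + 1) k : ℝ) := fun k => by
    rw [stirlingS, ← descPochhammer_map (Int.castRingHom ℝ), Polynomial.coeff_map]
    simp
  rw [Polynomial.eval_eq_sum_range, descPochhammer_natDegree, Finset.sum_range_succ',
    Finset.range_eq_Ico, Finset.sum_Ico_add' (fun k => (descPochhammer ℝ (n + 1)).coeff k * t ^ k)]
  have h0 : (descPochhammer ℝ (n + 1)).coeff 0 = 0 := by
    rw [Polynomial.coeff_zero_eq_eval_zero]
    simp
  rw [h0]
  simp only [hc, zero_mul, add_zero]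
  rfl

theorem integral_sub_half_mul_pow (k : ℕ) :
    ∫ t in (0 : ℝ)..1, (t - 1 / 2) * t ^ k = k / (2 * ((k + 1) * (k + 2))) := by
  have h : ∀ t : ℝ, (t - 1 / 2) * t ^ k = t ^ (k + 1) - 1 / 2 * t ^ k := fun t => by ring
  simp_rw [h]
  rw [intervalIntegral.integral_sub (by apply Continuous.intervalIntegrable; fun_prop)
    (by apply Continuous.intervalIntegrable; fun_prop), intervalIntegral.integral_const_mul,
    integral_pow, integral_pow]
  push_cast
  simp
  field_simp
  ring

/-- The weights `k / (2 (k + 1) (k + 2))` are the moments of `t - 1/2` on `[0, 1]`, so the Stirling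
sum integrates a falling factorial. -/
theorem binetCoeff_succ_eq_integral (n : ℕ) :
    (binetCoeff (n + 1) : ℝ) =
      1 / (n + 1) * ∫ t in (0 : ℝ)..1, (t - 1 / 2) * (t * risingProd (-t) n) := by
  have h : ∀ t : ℝ, (t - 1 / 2) * (t * risingProd (-t) n) =
      ∑ k ∈ Finset.Icc 1 (n + 1),
        ((-1) ^ n * (stirlingS (n + 1) k : ℝ)) * ((t - 1 / 2) * t ^ k) := fun t => by
    have h1 := eval_descPochhammer_succ n t
    rw [eval_descPochhammer_eq_sum] at h1
    have h2 : t * risingProd (-t) n =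
        (-1) ^ n * ∑ k ∈ Finset.Icc 1 (n + 1), (stirlingS (n + 1) k : ℝ) * t ^ k := by
      rw [h1, ← mul_assoc, ← mul_pow]
      simp
    rw [h2, Finset.mul_sum, Finset.mul_sum]
    exact Finset.sum_congr rfl fun k _ => by ring
  simp_rw [h]
  rw [intervalIntegral.integral_finsetSum
    fun k _ => by apply Continuous.intervalIntegrable; fun_prop]
  simp_rw [intervalIntegral.integral_const_mul, integral_sub_half_mul_pow]
  rw [binetCoeff]
  push_cast
  rw [Finset.mul_sum, Finset.mul_sum]
  refine Finset.sum_congr rfl fun k _ => ?_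
  field_simp

theorem abs_binetCoeff_succ_le (n : ℕ) :
    |(binetCoeff (n + 1) : ℝ)| ≤ n.factorial / (n + 1) := by
  have hn : (0 : ℝ) < 1 / (n + 1) := by positivity
  rw [binetCoeff_succ_eq_integral, abs_mul, abs_of_pos hn,
    div_eq_mul_one_div (n.factorial : ℝ), mul_comm]
  refine mul_le_mul_of_nonneg_right ?_ hn.le
  have := intervalIntegral.norm_integral_le_of_norm_le_const (a := (0 : ℝ)) (b := 1)
    (C := n.factorial) (f := fun t => (t - 1 / 2) * (t * risingProd (-t) n)) ?_
  · simpa using this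
  · intro t ht
    rw [Set.uIoc_of_le zero_le_one] at ht
    have h1 : |t - 1 / 2| ≤ 1 := by rw [abs_le]; constructor <;> linarith [ht.1, ht.2]
    have h2 := risingProd_neg_nonneg ht.2 n
    have h3 := risingProd_neg_le_factorial ht.1.le ht.2 n
    rw [norm_mul, norm_mul, Real.norm_eq_abs, Real.norm_eq_abs, Real.norm_eq_abs,
      abs_of_pos ht.1, abs_of_nonneg h2]
    calc |t - 1 / 2| * (t * risingProd (-t) n) ≤ 1 * (1 * risingProd (-t) n) := by
          gcongr
          exacts [mul_nonneg ht.1.le h2, ht.2]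
      _ ≤ _ := by simpa using h3

/-- The majorant depends on `δ` only: it gives summability, holomorphy and the decay along `x + n`.
-/
theorem norm_binetCoeff_div_le {δ : ℝ} (hδ : 0 < δ) {z : ℂ} (hz : δ ≤ z.re) (n : ℕ) :
    ‖(binetCoeff (n + 1) : ℂ) / risingProd z n‖ ≤
      (n.factorial : ℝ) / ((n + 1) * risingProd δ n) := by
  have h1 : ‖(binetCoeff (n + 1) : ℂ)‖ = |(binetCoeff (n + 1) : ℝ)| := by
    rw [← Complex.ofReal_ratCast, Complex.norm_real, Real.norm_eq_abs]
  rw [norm_div, h1, ← div_div]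
  refine div_le_div₀ (by positivity) (abs_binetCoeff_succ_le n) (risingProd_pos hδ.le n) ?_
  exact (risingProd_mono hδ.le hz n).trans (risingProd_re_le_norm (hδ.le.trans hz) n)

theorem summable_binetCoeff_div {z : ℂ} (hz : 0 < z.re) :
    Summable fun n : ℕ => (binetCoeff (n + 1) : ℂ) / risingProd z n :=
  .of_norm_bounded (summable_factorial_div_succ_mul_risingProd hz)
    (norm_binetCoeff_div_le hz le_rfl)

theorem ofReal_risingProd (x : ℝ) (n : ℕ) : ((risingProd x n : ℝ) : ℂ) = risingProd (x : ℂ) n := by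
  simp [risingProd]

theorem abs_binetCoeff_div_le {δ x : ℝ} (hδ : 0 < δ) (hx : δ ≤ x) (n : ℕ) :
    |(binetCoeff (n + 1) : ℝ) / risingProd x n| ≤
      (n.factorial : ℝ) / ((n + 1) * risingProd δ n) := by
  have h := norm_binetCoeff_div_le hδ (z := (x : ℂ)) (by simpa using hx) n
  rw [← ofReal_risingProd, ← Complex.ofReal_ratCast, ← Complex.ofReal_div, Complex.norm_real] at h
  exact h

theorem summable_real_binetCoeff_div {x : ℝ} (hx : 0 < x) :
    Summable fun n : ℕ => (binetCoeff (n + 1) : ℝ) / risingProd x n :=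
  .of_norm_bounded (summable_factorial_div_succ_mul_risingProd hx)
    (abs_binetCoeff_div_le hx le_rfl)

/-! ### Holomorphy and real values of `logGamma`. -/

theorem isOpen_re_pos : IsOpen {w : ℂ | 0 < w.re} :=
  isOpen_lt continuous_const Complex.continuous_re

theorem differentiableOn_Gamma_re_pos : DifferentiableOn ℂ Complex.Gamma {w : ℂ | 0 < w.re} := by
  intro w hw
  refine (Complex.differentiableAt_Gamma w fun m h => ?_).differentiableWithinAt
  have hw' : 0 < w.re := hw
  rw [h] at hw'
  simp at hw'
  linarith [(Nat.cast_nonneg m : (0 : ℝ) ≤ m)]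

theorem differentiableOn_digamma_re_pos :
    DifferentiableOn ℂ Complex.digamma {w : ℂ | 0 < w.re} :=
  (differentiableOn_Gamma_re_pos.deriv isOpen_re_pos).div differentiableOn_Gamma_re_pos
    fun _ hw => Complex.Gamma_ne_zero_of_re_pos hw

theorem segment_mem_of_convex {s : Set ℂ} (hs : Convex ℝ s) {z : ℂ} (h1 : 1 ∈ s) (hz : z ∈ s)
    {t : ℝ} (ht : t ∈ Set.Icc (0 : ℝ) 1) : 1 + (t : ℂ) * (z - 1) ∈ s := by
  have := hs.add_smul_sub_mem h1 hz ht
  simpa using this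

theorem logGamma_eq_sub_of_hasDerivAt {s : Set ℂ} (hs : Convex ℝ s) (hpos : ∀ w ∈ s, 0 < w.re)
    {L : ℂ → ℂ} (hL : ∀ w ∈ s, HasDerivAt L (Complex.digamma w) w) (h1 : 1 ∈ s) {z : ℂ}
    (hz : z ∈ s) : logGamma z = L z - L 1 := by
  have hγ : ∀ t : ℝ, HasDerivAt (fun t : ℝ => 1 + (t : ℂ) * (z - 1)) (z - 1) t := fun t => by
    simpa using ((Complex.ofRealCLM.hasDerivAt (x := t)).mul_const (z - 1)).const_add 1
  have hmem : ∀ t ∈ Set.uIcc (0 : ℝ) 1, 1 + (t : ℂ) * (z - 1) ∈ s := fun t ht =>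
    segment_mem_of_convex hs h1 hz (by rwa [Set.uIcc_of_le zero_le_one] at ht)
  have h := intervalIntegral.integral_eq_sub_of_hasDerivAt (a := (0 : ℝ)) (b := 1)
    (f := fun t : ℝ => L (1 + (t : ℂ) * (z - 1)))
    (f' := fun t : ℝ => (z - 1) * Complex.digamma (1 + (t : ℂ) * (z - 1)))
    (fun t ht => ((hL _ (hmem t ht)).comp t (hγ t)).congr_deriv (mul_comm _ _)) ?_
  · rw [logGamma, h]
    simp
  · refine ContinuousOn.intervalIntegrable (continuousOn_const.mul ?_)
    exact differentiableOn_digamma_re_pos.continuousOn.comp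
      (by fun_prop : Continuous fun t : ℝ => 1 + (t : ℂ) * (z - 1)).continuousOn
      fun t ht => hpos _ (hmem t ht)

theorem mem_ball_ofReal_iff {z : ℂ} {R : ℝ} (hR : 0 < R) :
    z ∈ Metric.ball (R : ℂ) R ↔ Complex.normSq z < 2 * R * z.re := by
  rw [Metric.mem_ball, Complex.dist_eq, ← sq_lt_sq₀ (norm_nonneg _) hR.le,
    ← Complex.normSq_eq_norm_sq, Complex.normSq_apply, Complex.normSq_apply]
  simp only [Complex.sub_re, Complex.sub_im, Complex.ofReal_re, Complex.ofReal_im]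
  constructor <;> intro h <;> nlinarith

theorem hasDerivAt_logGamma {z : ℂ} (hz : 0 < z.re) :
    HasDerivAt logGamma (Complex.digamma z) z := by
  -- The discs with centre and radius `R` exhaust the half plane; this `R` captures both `1` and
  -- `z`. On a disc `digamma` has a primitive.
  obtain ⟨R, hR0, hR1, hRz⟩ : ∃ R : ℝ, 0 < R ∧ 1 < 2 * R ∧ Complex.normSq z < 2 * R * z.re := by
    refine ⟨1 + Complex.normSq z / z.re, ?_, ?_, ?_⟩
    · have := Complex.normSq_nonneg z
      positivity
    · have : 0 ≤ Complex.normSq z / z.re := div_nonneg (Complex.normSq_nonneg z) hz.le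
      linarith
    · have h : (1 + Complex.normSq z / z.re) * z.re = z.re + Complex.normSq z := by
        field_simp
      nlinarith [Complex.normSq_nonneg z]
  have hpos : ∀ w ∈ Metric.ball (R : ℂ) R, 0 < w.re := fun w hw => by
    have h := (mem_ball_ofReal_iff hR0).1 hw
    have : 0 < 2 * R * w.re := (Complex.normSq_nonneg w).trans_lt h
    exact pos_of_mul_pos_right this (by positivity)
  have hmz : z ∈ Metric.ball (R : ℂ) R := (mem_ball_ofReal_iff hR0).2 hRz
  have hm1 : (1 : ℂ) ∈ Metric.ball (R : ℂ) R := (mem_ball_ofReal_iff hR0).2 (by simpa using hR1)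
  obtain ⟨L, hL⟩ := (differentiableOn_digamma_re_pos.mono hpos).isExactOn_ball
  refine ((hL z hmz).sub_const (L 1)).congr_of_eventuallyEq ?_
  filter_upwards [Metric.isOpen_ball.mem_nhds hmz] with w hw
  exact logGamma_eq_sub_of_hasDerivAt (convex_ball _ _) hpos hL hm1 hw

theorem digamma_ofReal {x : ℝ} (hx : 0 < x) :
    Complex.digamma (x : ℂ) = ((deriv Real.Gamma x / Real.Gamma x : ℝ) : ℂ) := by
  have h1 : HasDerivAt (fun y : ℝ => Complex.Gamma y) (deriv Complex.Gamma x) x :=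
    (differentiableOn_Gamma_re_pos.differentiableAt
      (isOpen_re_pos.mem_nhds (by simpa using hx))).hasDerivAt.comp_ofReal
  have h2 : HasDerivAt (fun y : ℝ => (Real.Gamma y : ℂ)) (deriv Real.Gamma x : ℝ) x :=
    (Real.differentiableAt_Gamma fun m => by
      have : (0 : ℝ) ≤ m := Nat.cast_nonneg m
      intro h
      linarith).hasDerivAt.ofReal_comp
  simp only [Complex.Gamma_ofReal] at h1
  rw [Complex.digamma_def, logDeriv_apply, h1.unique h2, Complex.Gamma_ofReal, Complex.ofReal_div]

/-- The exponential fixes `logGamma` only modulo `2πi`; the integrand is real here, which removes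
the ambiguity. -/
theorem logGamma_ofReal {x : ℝ} (hx : 0 < x) :
    logGamma (x : ℂ) = (Real.log (Real.Gamma x) : ℂ) := by
  have hreal : logGamma (x : ℂ) = ((∫ t in (0 : ℝ)..1, (x - 1) *
      (deriv Real.Gamma (1 + t * (x - 1)) / Real.Gamma (1 + t * (x - 1))) : ℝ) : ℂ) := by
    rw [logGamma, ← intervalIntegral.integral_ofReal]
    refine intervalIntegral.integral_congr fun t ht => ?_
    rw [Set.uIcc_of_le zero_le_one] at ht
    have hpos : 0 < 1 + t * (x - 1) := by
      have := (convex_Ioi (0 : ℝ)).add_smul_sub_mem (x := 1) (y := x) (Set.mem_Ioi.2 zero_lt_one) hx ht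
      simpa using this
    have h := digamma_ofReal hpos
    push_cast at h ⊢
    rw [h]
  have hexp := exp_logGamma (z := (x : ℂ)) (by simpa using hx)
  rw [hreal] at hexp ⊢
  rw [Complex.Gamma_ofReal] at hexp
  rw [← Complex.ofReal_exp] at hexp
  rw [← Complex.ofReal_inj.1 hexp, Real.log_exp]

theorem differentiableOn_binetMu : DifferentiableOn ℂ binetMu {w : ℂ | 0 < w.re} := by
  intro w hw
  have h1 := (hasDerivAt_logGamma hw).differentiableAt
  have h2 : DifferentiableAt ℂ Complex.log w := Complex.differentiableAt_log (Or.inl hw)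
  unfold binetMu
  exact ((h1.sub ((differentiableAt_id.sub_const _).mul h2)).add differentiableAt_id
    |>.sub_const _).differentiableWithinAt

/-! ### Binet's function on the positive axis. -/

/-- Binet's function on the positive real axis. -/
def realBinetMu (x : ℝ) : ℝ :=
  Real.log (Real.Gamma x) - (x - 1 / 2) * Real.log x + x - 1 / 2 * Real.log (2 * Real.pi)

theorem binetMu_ofReal {x : ℝ} (hx : 0 < x) : binetMu (x : ℂ) = (realBinetMu x : ℂ) := by
  have h : Complex.log (2 * (Real.pi : ℂ)) = (Real.log (2 * Real.pi) : ℂ) := by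
    rw [Complex.ofReal_log (by positivity)]
    push_cast
    rfl
  rw [binetMu, realBinetMu, logGamma_ofReal hx, h, ← Complex.ofReal_log hx.le]
  push_cast
  rfl

theorem realBinetMu_sub_add_one {x : ℝ} (hx : 0 < x) :
    realBinetMu x - realBinetMu (x + 1) = (x + 1 / 2) * Real.log ((x + 1) / x) - 1 := by
  rw [realBinetMu, realBinetMu, Real.Gamma_add_one hx.ne',
    Real.log_mul hx.ne' (Real.Gamma_pos_of_pos hx).ne', Real.log_div (by positivity) hx.ne']
  ring

theorem tendsto_log_factorial_stirling :
    Tendsto (fun n : ℕ => Real.log n.factorial - (n + 1 / 2) * Real.log n + n) atTop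
      (𝓝 (1 / 2 * Real.log (2 * Real.pi))) := by
  have h := (Stirling.tendsto_stirlingSeq_sqrt_pi.log
    (Real.sqrt_ne_zero'.2 Real.pi_pos)).add_const (1 / 2 * Real.log 2)
  have h2 : Real.log √Real.pi + 1 / 2 * Real.log 2 = 1 / 2 * Real.log (2 * Real.pi) := by
    rw [Real.log_sqrt Real.pi_pos.le, Real.log_mul two_ne_zero Real.pi_ne_zero]
    ring
  rw [h2] at h
  refine h.congr' ?_
  filter_upwards [eventually_gt_atTop 0] with n hn
  have hn' : (n : ℝ) ≠ 0 := by positivity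
  rw [Stirling.log_stirlingSeq_formula, Real.log_mul two_ne_zero hn',
    Real.log_div hn' (Real.exp_ne_zero 1), Real.log_exp]
  ring

theorem tendsto_mul_log_shift (x : ℝ) :
    Tendsto (fun n : ℕ => (x + n + 1 / 2) * (Real.log (x + n + 1) - Real.log n)) atTop
      (𝓝 (x + 1)) := by
  have h1 : Tendsto (fun n : ℕ => (n : ℝ) * Real.log (1 + (x + 1) / n)) atTop (𝓝 (x + 1)) :=
    (Real.tendsto_mul_log_one_add_div_atTop (x + 1)).comp tendsto_natCast_atTop_atTop
  have h2 : Tendsto (fun n : ℕ => 1 + (x + 1 / 2) / (n : ℝ)) atTop (𝓝 1) := by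
    simpa using (tendsto_const_div_atTop_nhds_zero_nat (x + 1 / 2)).const_add 1
  have h3 := h2.mul h1
  rw [one_mul] at h3
  refine h3.congr' ?_
  filter_upwards [eventually_gt_atTop 0,
    (tendsto_natCast_atTop_atTop (R := ℝ)).eventually_gt_atTop (-(x + 1))] with n hn hn2
  have hn' : (n : ℝ) ≠ 0 := by positivity
  have hn3 : x + n + 1 ≠ 0 := by
    have : 0 < x + n + 1 := by linarith
    exact this.ne'
  rw [← Real.log_div hn3 hn']
  have : 1 + (x + 1) / (n : ℝ) = (x + n + 1) / n := by
    field_simp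
    ring
  rw [this]
  field_simp
  ring

theorem tendsto_realBinetMu_add_nat {x : ℝ} (hx : 0 < x) :
    Tendsto (fun n : ℕ => realBinetMu (x + n)) atTop (𝓝 0) := by
  -- The shift matches the `n + 1` logarithms in `logGammaSeq x n`.
  rw [← tendsto_add_atTop_iff_nat 1]
  have h1 := Real.BohrMollerup.tendsto_log_gamma hx
  have h := ((tendsto_log_factorial_stirling.sub h1).sub (tendsto_mul_log_shift x)).add_const
    (Real.log (Real.Gamma x) + (x + 1) - 1 / 2 * Real.log (2 * Real.pi))
  have h0 : 1 / 2 * Real.log (2 * Real.pi) - Real.log (Real.Gamma x) - (x + 1) +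
      (Real.log (Real.Gamma x) + (x + 1) - 1 / 2 * Real.log (2 * Real.pi)) = 0 := by ring
  rw [h0] at h
  refine h.congr fun n => ?_
  have hG := Real.BohrMollerup.f_add_nat_eq (f := fun y => Real.log (Real.Gamma y))
    (fun {y} hy => by
      rw [Real.Gamma_add_one hy.ne', Real.log_mul hy.ne' (Real.Gamma_pos_of_pos hy).ne', add_comm])
    hx (n + 1)
  rw [realBinetMu, hG, Real.BohrMollerup.logGammaSeq]
  push_cast
  rw [← add_assoc]
  ring_nf

/-! ### The series on the positive axis. -/

/-- The inverse factorial series on the positive real axis. -/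
def realBinetSeries (x : ℝ) : ℝ :=
  1 / x * ∑' n : ℕ, (binetCoeff (n + 1) : ℝ) / risingProd x n

theorem integral_sub_half_mul_div_add {x : ℝ} (hx : 0 < x) :
    ∫ t in (0 : ℝ)..1, (t - 1 / 2) * t * (1 / (x + t)) =
      x * ((x + 1 / 2) * Real.log ((x + 1) / x) - 1) := by
  have hpos : ∀ t ∈ Set.uIcc (0 : ℝ) 1, x + t ≠ 0 := fun t ht => by
    rw [Set.uIcc_of_le zero_le_one] at ht
    linarith [ht.1]
  -- Division gives `t - (1/2 + x) + x (x + 1/2) / (x + t)` for the integrand.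
  rw [intervalIntegral.integral_eq_sub_of_hasDerivAt
    (f := fun t => t ^ 2 / 2 - (1 / 2 + x) * t + x * (x + 1 / 2) * Real.log (x + t))]
  · rw [Real.log_div (by positivity) hx.ne', add_zero]
    ring
  · intro t ht
    have h1 := (((hasDerivAt_id t).pow 2).div_const 2).sub
      ((hasDerivAt_id t).const_mul (1 / 2 + x))
    have h2 := (((hasDerivAt_id t).const_add x).log (hpos t ht)).const_mul (x * (x + 1 / 2))
    refine (h1.add h2).congr_deriv ?_
    have := hpos t ht
    simp only [id]
    field_simp
    ring
  · refine ContinuousOn.intervalIntegrable ?_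
    exact (by fun_prop : Continuous fun t : ℝ => (t - 1 / 2) * t).continuousOn.mul
      (continuousOn_const.div (by fun_prop) hpos)

/-- Gauss's sum inside the integral; the dominating terms are its own terms at `t = 0`. -/
theorem hasSum_succ_mul_binetCoeff_div {x : ℝ} (hx : 0 < x) :
    HasSum (fun n : ℕ => ((n : ℝ) + 1) * binetCoeff (n + 1) / risingProd x (n + 1))
      (x * ((x + 1 / 2) * Real.log ((x + 1) / x) - 1)) := by
  rw [← integral_sub_half_mul_div_add hx]
  have h := intervalIntegral.hasSum_integral_of_dominated_convergence (μ := volume)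
    (a := (0 : ℝ)) (b := 1)
    (F := fun (n : ℕ) t => (t - 1 / 2) * t * (risingProd (-t) n / risingProd x (n + 1)))
    (f := fun t => (t - 1 / 2) * t * (1 / (x + t)))
    (fun n _ => (n.factorial : ℝ) / risingProd x (n + 1)) ?_ ?_ ?_ ?_ ?_
  · refine h.congr_fun fun n => ?_
    rw [binetCoeff_succ_eq_integral, ← mul_assoc, mul_one_div_cancel (by positivity), one_mul,
      ← intervalIntegral.integral_div]
    exact intervalIntegral.integral_congr fun t _ => by ring
  · intro n
    have := continuous_risingProd (R := ℝ) n
    exact (by fun_prop : Continuous fun t : ℝ =>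
      (t - 1 / 2) * t * (risingProd (-t) n / risingProd x (n + 1))).aestronglyMeasurable
  · refine fun n => .of_forall fun t ht => ?_
    rw [Set.uIoc_of_le zero_le_one] at ht
    have h1 : |t - 1 / 2| ≤ 1 := by rw [abs_le]; constructor <;> linarith [ht.1, ht.2]
    have h2 := risingProd_neg_nonneg ht.2 n
    have h3 := risingProd_neg_le_factorial ht.1.le ht.2 n
    have h4 := risingProd_pos hx.le (n + 1)
    rw [norm_mul, norm_mul, Real.norm_eq_abs, Real.norm_eq_abs, Real.norm_eq_abs,
      abs_of_pos ht.1, abs_of_nonneg (div_nonneg h2 h4.le)]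
    calc |t - 1 / 2| * t * (risingProd (-t) n / risingProd x (n + 1))
        ≤ 1 * 1 * (n.factorial / risingProd x (n + 1)) := by
          gcongr
          exacts [ht.1.le, ht.2]
      _ = _ := by ring
  · exact .of_forall fun _ _ => summable_factorial_div_risingProd_succ hx
  · exact intervalIntegrable_const
  · refine .of_forall fun t ht => ?_
    rw [Set.uIoc_of_le zero_le_one] at ht
    exact (hasSum_risingProd_neg_div hx ht.1.le ht.2).mul_left _

theorem realBinetSeries_sub_add_one {x : ℝ} (hx : 0 < x) :
    realBinetSeries x - realBinetSeries (x + 1) = (x + 1 / 2) * Real.log ((x + 1) / x) - 1 := by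
  have hx1 : 0 < x + 1 := by linarith
  have h := ((summable_real_binetCoeff_div hx).hasSum.mul_left (1 / x)).sub
    ((summable_real_binetCoeff_div hx1).hasSum.mul_left (1 / (x + 1)))
  have h2 := (hasSum_succ_mul_binetCoeff_div hx).mul_left (1 / x)
  rw [← mul_assoc, one_div_mul_cancel hx.ne', one_mul] at h2
  refine h.unique (h2.congr_fun fun n => ?_)
  -- Both terms now share a denominator, and `(x + n + 1) - x = n + 1` supplies the factor.
  have h3 : 1 / (x + 1) * ((binetCoeff (n + 1) : ℝ) / risingProd (x + 1) n) =
      binetCoeff (n + 1) / risingProd x (n + 1) := by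
    rw [← risingProd_add_one, div_mul_div_comm, one_mul]
  rw [h3, risingProd_succ]
  have := (risingProd_pos hx.le n).ne'
  have : x + ((n : ℝ) + 1) ≠ 0 := by positivity
  field_simp
  ring

theorem tendsto_realBinetSeries_add_nat {x : ℝ} (hx : 0 < x) :
    Tendsto (fun n : ℕ => realBinetSeries (x + n)) atTop (𝓝 0) := by
  have hinv : Tendsto (fun n : ℕ => 1 / (x + n)) atTop (𝓝 0) := by
    simp_rw [one_div]
    exact (tendsto_atTop_add_const_left _ x tendsto_natCast_atTop_atTop).inv_tendsto_atTop
  have h := hinv.mul_const (∑' n : ℕ, (n.factorial : ℝ) / ((n + 1) * risingProd x n))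
  rw [zero_mul] at h
  refine squeeze_zero_norm (fun n => ?_) h
  have hn : 0 < x + n := by positivity
  rw [realBinetSeries, norm_mul, Real.norm_of_nonneg (one_div_pos.2 hn).le]
  refine mul_le_mul_of_nonneg_left ?_ (one_div_pos.2 hn).le
  exact tsum_of_norm_bounded (summable_factorial_div_succ_mul_risingProd hx).hasSum
    (abs_binetCoeff_div_le hx (by linarith [(Nat.cast_nonneg n : (0 : ℝ) ≤ n)]))

theorem realBinetMu_eq_realBinetSeries {x : ℝ} (hx : 0 < x) :
    realBinetMu x = realBinetSeries x := by
  have hconst : ∀ n : ℕ, realBinetMu (x + n) - realBinetSeries (x + n) =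
      realBinetMu x - realBinetSeries x := by
    intro n
    induction n with
    | zero => simp
    | succ n ih =>
      have hn : 0 < x + n := by positivity
      have h1 := realBinetMu_sub_add_one hn
      have h2 := realBinetSeries_sub_add_one hn
      push_cast
      rw [← add_assoc]
      linarith
  have h := (tendsto_realBinetMu_add_nat hx).sub (tendsto_realBinetSeries_add_nat hx)
  simp_rw [hconst, sub_zero] at h
  exact sub_eq_zero.1 (tendsto_nhds_unique tendsto_const_nhds h)

/-! ### Analytic continuation to the half plane. -/

theorem differentiableOn_binetSeries :
    DifferentiableOn ℂ
      (fun z : ℂ => 1 / z * ∑' n : ℕ, (binetCoeff (n + 1) : ℂ) / risingProd z n)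
      {w : ℂ | 0 < w.re} := by
  intro w hw
  have hw0 : w ≠ 0 := by
    rintro rfl
    simp at hw
  have hδ : 0 < w.re / 2 := half_pos hw
  have hopen : IsOpen {v : ℂ | w.re / 2 < v.re} := isOpen_lt continuous_const Complex.continuous_re
  have hd : DifferentiableOn ℂ (fun z : ℂ => ∑' n : ℕ, (binetCoeff (n + 1) : ℂ) / risingProd z n)
      {v : ℂ | w.re / 2 < v.re} := by
    refine Complex.differentiableOn_tsum_of_summable_norm
      (summable_factorial_div_succ_mul_risingProd hδ) (fun n => ?_) hopen
      fun n v hv => norm_binetCoeff_div_le hδ (le_of_lt hv) n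
    refine (differentiableOn_const _).div ?_ fun v hv => ?_
    · unfold risingProd
      fun_prop
    · have hv0 : 0 ≤ v.re := hδ.le.trans (le_of_lt hv)
      exact norm_pos_iff.1 ((risingProd_pos hv0 n).trans_le (risingProd_re_le_norm hv0 n))
  have hw2 : w ∈ {v : ℂ | w.re / 2 < v.re} := half_lt_self (show 0 < w.re from hw)
  exact (((differentiableAt_const _).div differentiableAt_id hw0).mul
    (hd.differentiableAt (hopen.mem_nhds hw2))).differentiableWithinAt

theorem binetSeries_ofReal (x : ℝ) :
    1 / (x : ℂ) * ∑' n : ℕ, (binetCoeff (n + 1) : ℂ) / risingProd (x : ℂ) n =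
      (realBinetSeries x : ℂ) := by
  rw [realBinetSeries]
  push_cast
  simp_rw [ofReal_risingProd]

/-- Reals decreasing to `1` supply the accumulation point for the identity theorem. -/
theorem frequently_ofReal_nhdsNE_one {p : ℂ → Prop} (hp : ∀ x : ℝ, 0 < x → p x) :
    ∃ᶠ z in 𝓝[≠] (1 : ℂ), p z := by
  have h : Tendsto (fun x : ℝ => (x : ℂ)) (𝓝[>] 1) (𝓝[≠] 1) := by
    refine tendsto_nhdsWithin_iff.2 ⟨?_, ?_⟩
    · exact (Complex.continuous_ofReal.tendsto' 1 1 Complex.ofReal_one).mono_left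
        nhdsWithin_le_nhds
    · filter_upwards [self_mem_nhdsWithin] with x hx
      exact fun h => (ne_of_gt hx) (Complex.ofReal_eq_one.1 h)
  refine h.frequently (Eventually.frequently ?_)
  filter_upwards [self_mem_nhdsWithin] with x hx
  exact hp x (zero_lt_one.trans hx)

theorem binetMu_eq_series {z : ℂ} (hz : 0 < z.re) :
    binetMu z = 1 / z * ∑' n : ℕ, (binetCoeff (n + 1) : ℂ) / risingProd z n :=
  (differentiableOn_binetMu.analyticOnNhd isOpen_re_pos).eqOn_of_preconnected_of_frequently_eq
    (differentiableOn_binetSeries.analyticOnNhd isOpen_re_pos)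
    (convex_halfSpace_re_gt 0).isPreconnected (by simp : (1 : ℂ) ∈ {w : ℂ | 0 < w.re})
    (frequently_ofReal_nhdsNE_one fun x hx => by
      rw [binetMu_ofReal hx, binetSeries_ofReal, realBinetMu_eq_realBinetSeries hx]) hz

end BinetSeries

end

theorem theorem1 (z : ℂ) (hz : 0 < z.re) :
    Summable (fun m : ℕ =>
      (BinetSeries.binetCoeff (m + 1) : ℂ) / ∏ k ∈ Finset.Icc 1 m, (z + (k : ℂ))) ∧
    BinetSeries.binetMu z =
      1 / z * ∑' m : ℕ,
        (BinetSeries.binetCoeff (m + 1) : ℂ) / ∏ k ∈ Finset.Icc 1 m, (z + (k : ℂ)) :=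
  ⟨BinetSeries.summable_binetCoeff_div hz, BinetSeries.binetMu_eq_series hz⟩
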